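/- Let $\mathbb{F}\in\{\mathbb{R},\mathbb{C}\}$ and let $T$ be an $n\times n$ matrix over $\mathbb{F}$, acting on $\mathbb{F}^n$ by $v\mapsto Tv$. A vector $v\in\mathbb{F}^n$ is a cyclic vector for $T$ if the linear span (over $\mathbb{F}$) of its orbit $\{v,Tv,T^2v,\ldots\}$ is dense in $\mathbb{F}^n$, and a convex-cyclic vector for $T$ if the convex hull (convex combinations with real coefficients) of its orbit is dense in $\mathbb{F}^n$. The matrix $T$ is cyclic (respectively convex-cyclic) on $\mathbb{F}^n$ if it has a cyclic (respectively convex-cyclic) vector. Write $\overline{\mathbb{D}}=\{z\in\mathbb{C}:|z|\le 1\}$ and $\mathbb{R}^+=(0,\infty)$. (1) The real case. If $T$ is a real $n\times n$ matrix, then $T$ is convex-cyclic on $\mathbb{R}^n$ if and only if $T$ is cyclic on $\mathbb{R}^n$ and all its real and complex eigenvalues (that is, all eigenvalues of $T$ regarded as a complex matrix) lie in $\mathbb{C}\setminus(\overline{\mathbb{D}}\cup\mathbb{R}^+)$. If $T$ is convex-cyclic, then the convex-cyclic vectors for $T$ are exactly the cyclic vectors for $T$, and they form a dense set in $\mathbb{R}^n$.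 (2) The complex case. If $T$ is a complex $n\times n$ matrix, then $T$ is convex-cyclic on $\mathbb{C}^n$ if and only if $T$ is cyclic on $\mathbb{C}^n$, all its eigenvalues lie in $\mathbb{C}\setminus(\overline{\mathbb{D}}\cup\mathbb{R})$, and $\lambda\neq\overline{\mu}$ for all eigenvalues $\lambda,\mu$ of $T$. If $T$ is convex-cyclic, then the convex-cyclic vectors for $T$ are exactly the cyclic vectors for $T$, and they form a dense set in $\mathbb{C}^n$. -/

import Mathlib

/-- The orbit `{x, T x, T² x, …}` of `x` under `T`. -/
def operatorOrbit {𝕜 X : Type*} [RCLike 𝕜] [AddCommGroup X] [Module 𝕜 X] [TopologicalSpace X]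
    (T : X →L[𝕜] X) (x : X) : Set X :=
  Set.range fun k : ℕ => (⇑T)^[k] x

/-- `x` is a cyclic vector for `T`: the linear span (over `𝕜`) of the orbit of `x` is dense. -/
def IsCyclicVector {𝕜 X : Type*} [RCLike 𝕜] [AddCommGroup X] [Module 𝕜 X] [TopologicalSpace X]
    (T : X →L[𝕜] X) (x : X) : Prop :=
  Dense (Submodule.span 𝕜 (operatorOrbit T x) : Set X)

/-- `x` is a convex-cyclic vector for `T`: the convex hull of the orbit of `x` is dense. -/
def IsConvexCyclicVector {𝕜 X : Type*} [RCLike 𝕜] [AddCommGroup X] [Module 𝕜 X] [Module ℝ X]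
    [TopologicalSpace X] (T : X →L[𝕜] X) (x : X) : Prop :=
  Dense (convexHull ℝ (operatorOrbit T x))

/-- `T` is a cyclic operator: it has a cyclic vector. -/
def IsCyclicOperator {𝕜 X : Type*} [RCLike 𝕜] [AddCommGroup X] [Module 𝕜 X] [TopologicalSpace X]
    (T : X →L[𝕜] X) : Prop :=
  ∃ x : X, IsCyclicVector T x

/-- `T` is a convex-cyclic operator: it has a convex-cyclic vector. -/
def IsConvexCyclicOperator {𝕜 X : Type*} [RCLike 𝕜] [AddCommGroup X] [Module 𝕜 X] [Module ℝ X]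
    [TopologicalSpace X] (T : X →L[𝕜] X) : Prop :=
  ∃ x : X, IsConvexCyclicVector T x

/-- The operator `v ↦ A v` on `𝕜ⁿ` (with its usual topology) given by a matrix `A`. -/
noncomputable def matrixOperator {𝕜 : Type*} [RCLike 𝕜] {n : ℕ} (A : Matrix (Fin n) (Fin n) 𝕜) :
    (Fin n → 𝕜) →L[𝕜] (Fin n → 𝕜) :=
  LinearMap.toContinuousLinearMap (Matrix.toLin' A)

/-- The set of eigenvalues in `ℂ` of a complex matrix. -/
def complexEigenvalues {n : ℕ} (A : Matrix (Fin n) (Fin n) ℂ) : Set ℂ :=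
  {μ : ℂ | Module.End.HasEigenvalue (Matrix.toLin' A) μ}

/-! By Hahn-Banach, `v` is convex-cyclic once every real functional `f` with `a k = f (T^k v)`
bounded above vanishes. Necessity: a left eigenvector gives `φ` with `φ ∘ T = z φ`. If `|z| ≤ 1` or
`z > 0`, suitable real parts of multiples of `φ` are bounded above on the orbit, so `φ = 0`. Over
`ℂ`, eigenvalues `z` and `z̄` yield a nonzero combination of eigenfunctionals that is purely
imaginary on the orbit. Sufficiency: the characteristic polynomial divides a real `Q` with
nonnegative coefficients, `Q(0) > 0` and all roots outside the closed disc
(`exists_nonneg_coeff_multiple`). Then `a` satisfies the recurrence `Q`; bounded above, it is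
bounded, hence zero (`eq_zero_of_bddAbove_of_recurrence`). Cyclicity turns this into `f = 0`, over
`ℂ` with the help of coprimality of the characteristic polynomial and its conjugate. -/

open Polynomial

/-! ### Multiples with nonnegative coefficients -/

theorem exists_pow_re_nonpos {z : ℂ} (hz : ∀ r : ℝ, 0 ≤ r → z ≠ r) :
    ∃ m : ℕ, 0 < m ∧ (z ^ m).re ≤ 0 := by
  by_contra! h
  have hz0 : z ≠ 0 := fun h0 => hz 0 le_rfl (by simp [h0])
  -- All positive powers lie in the right half-plane, so squaring doubles the argument without
  -- wrapping; boundedness by `π` then forces it to be zero.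
  have harg : ∀ j : ℕ, (z ^ 2 ^ j).arg = 2 ^ j * z.arg := by
    intro j
    induction j with
    | zero => simp
    | succ j ih =>
      have hlt := Complex.abs_arg_lt_pi_div_two_iff.2 (Or.inl (h (2 ^ j) (by positivity)))
      rw [abs_lt] at hlt
      have h0 : z ^ 2 ^ j ≠ 0 := pow_ne_zero _ hz0
      rw [pow_succ, pow_mul, sq, Complex.arg_mul h0 h0 ⟨by linarith, by linarith⟩, ih, pow_succ]
      ring
  have harg0 : z.arg = 0 := by
    by_contra hne
    obtain ⟨j, hj⟩ := pow_unbounded_of_one_lt (Real.pi / |z.arg|) (one_lt_two : (1 : ℝ) < 2)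
    rw [div_lt_iff₀ (abs_pos.2 hne)] at hj
    have := Complex.abs_arg_le_pi (z ^ 2 ^ j)
    rw [harg, abs_mul, abs_of_pos (by positivity : (0 : ℝ) < 2 ^ j)] at this
    linarith
  obtain ⟨hre, him⟩ := Complex.arg_eq_zero_iff.1 harg0
  exact hz z.re hre (Complex.ext (by simp) (by simpa using him))

/-- Every polynomial whose roots lie off the closed unit disc and the positive real axis divides a
real polynomial with nonnegative coefficients whose roots lie off the closed unit disc. -/
theorem exists_nonneg_coeff_multiple (s : Multiset ℂ)
    (hs : ∀ z ∈ s, 1 < ‖z‖ ∧ ∀ r : ℝ, 0 < r → z ≠ r) :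
    ∃ Q : ℝ[X], (∀ j, 0 ≤ Q.coeff j) ∧ 0 < Q.coeff 0 ∧
      (s.map fun z => X - C z).prod ∣ Q.map (algebraMap ℝ ℂ) ∧
      ∀ z : ℂ, (Q.map (algebraMap ℝ ℂ)).IsRoot z → 1 < ‖z‖ := by
  induction s using Multiset.induction_on with
  | empty => exact ⟨1, fun j => by rw [coeff_one]; split_ifs <;> norm_num, by simp, by simp, by simp⟩
  | cons z s ih =>
    obtain ⟨Q, hQ, hQ0, hdvd, hroot⟩ := ih fun w hw => hs w (Multiset.mem_cons_of_mem hw)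
    obtain ⟨hz1, hzpos⟩ := hs z (Multiset.mem_cons_self _ _)
    obtain ⟨m, hm, hre⟩ := exists_pow_re_nonpos (z := z) fun r hr h => by
      rcases hr.eq_or_lt with rfl | hr
      · simp [h] at hz1; linarith
      · exact hzpos r hr h
    -- This is `(X^m - z^m)(X^m - conj (z^m))`; the choice of `m` makes its middle coefficient
    -- nonnegative, and its roots have modulus `‖z‖`.
    set q : ℝ[X] := X ^ (2 * m) + C (-2 * (z ^ m).re) * X ^ m + C (Complex.normSq (z ^ m)) with hq
    have hqmap : q.map (algebraMap ℝ ℂ) =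
        (X ^ m - C (z ^ m)) * (X ^ m - C ((starRingEnd ℂ) (z ^ m))) := by
      have h1 : (((-2 * (z ^ m).re : ℝ)) : ℂ) = -(z ^ m + (starRingEnd ℂ) (z ^ m)) := by
        rw [Complex.add_conj]; push_cast; ring
      have h2 : ((Complex.normSq (z ^ m) : ℝ) : ℂ) = z ^ m * (starRingEnd ℂ) (z ^ m) :=
        (Complex.mul_conj _).symm
      rw [hq, Polynomial.map_add, Polynomial.map_add, Polynomial.map_mul, map_C, map_C,
        Polynomial.map_pow, Polynomial.map_pow, map_X, Complex.coe_algebraMap, h1, h2]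
      simp only [map_add, map_neg, map_mul]
      ring
    have hqnn : ∀ j, 0 ≤ q.coeff j := by
      intro j
      rw [hq, coeff_add, coeff_add, coeff_C_mul, coeff_X_pow, coeff_X_pow, coeff_C]
      have := Complex.normSq_nonneg (z ^ m)
      split_ifs <;> nlinarith
    refine ⟨q * Q, fun j => ?_, ?_, ?_, ?_⟩
    · rw [coeff_mul]
      exact Finset.sum_nonneg fun x _ => mul_nonneg (hqnn _) (hQ _)
    · rw [mul_coeff_zero]
      refine mul_pos ?_ hQ0
      have hz0 : z ≠ 0 := by rintro rfl; simp at hz1; linarith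
      have : 0 < Complex.normSq (z ^ m) := Complex.normSq_pos.2 (pow_ne_zero _ hz0)
      rw [hq, coeff_add, coeff_add, coeff_C_mul, coeff_X_pow, coeff_X_pow, coeff_C,
        if_neg (by omega), if_neg (by omega), if_pos rfl]
      linarith
    · rw [Multiset.map_cons, Multiset.prod_cons, Polynomial.map_mul]
      refine mul_dvd_mul ?_ hdvd
      rw [hqmap, C_pow]
      exact (sub_dvd_pow_sub_pow X (C z) m).mul_right _
    · intro w hw
      rw [Polynomial.map_mul, IsRoot, eval_mul, mul_eq_zero] at hw
      refine hw.elim (fun hw => ?_) (hroot w)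
      have hn : ‖w‖ ^ m = ‖z‖ ^ m := by
        rw [hqmap, eval_mul, mul_eq_zero] at hw
        rcases hw with hw | hw
        · rw [eval_sub, eval_pow, eval_X, eval_C, sub_eq_zero] at hw
          rw [← norm_pow, hw, norm_pow]
        · rw [eval_sub, eval_pow, eval_X, eval_C, sub_eq_zero] at hw
          rw [← norm_pow, hw, RCLike.norm_conj, norm_pow]
      rwa [(pow_left_inj₀ (norm_nonneg _) (norm_nonneg _) hm.ne').1 hn]

/-! ### Linear recurrences and bounded sequences -/

/-- The left shift on sequences. -/
def leftShift (R : Type*) [CommSemiring R] : Module.End R (ℕ → R) :=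
  LinearMap.funLeft R R Nat.succ

theorem leftShift_pow_apply {R : Type*} [CommSemiring R] (j : ℕ) (a : ℕ → R) (k : ℕ) :
    (leftShift R ^ j) a k = a (k + j) := by
  induction j generalizing k with
  | zero => simp
  | succ j ih =>
    rw [pow_succ', Module.End.mul_apply]
    change ((leftShift R ^ j) a) (k + 1) = _
    rw [ih]
    congr 1
    omega

theorem aeval_leftShift_apply {R : Type*} [CommSemiring R] (p : R[X]) (a : ℕ → R) (k : ℕ) :
    aeval (leftShift R) p a k = ∑ j ∈ Finset.range (p.natDegree + 1), p.coeff j * a (k + j) := by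
  simp [aeval_eq_sum_range, LinearMap.sum_apply, Finset.sum_apply, leftShift_pow_apply]

theorem eq_zero_of_bounded_of_aeval_leftShift_prod (s : Multiset ℂ) (hs : ∀ z ∈ s, 1 < ‖z‖)
    {a : ℕ → ℂ} (ha : ∃ B, ∀ k, ‖a k‖ ≤ B)
    (h : aeval (leftShift ℂ) (s.map fun z => X - C z).prod a = 0) : a = 0 := by
  induction s using Multiset.induction_on generalizing a with
  | empty => simpa using h
  | cons z s ih =>
    have hz : 1 < ‖z‖ := hs z (Multiset.mem_cons_self _ _)
    obtain ⟨B, hB⟩ := ha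
    have hval : ∀ k, aeval (leftShift ℂ) (X - C z) a k = a (k + 1) - z * a k := fun k => by
      simp [Algebra.algebraMap_eq_smul_one, leftShift, LinearMap.funLeft_apply]
    -- The bounded sequence `(S - z) a`, with `S` the shift, is killed by the remaining factors;
    -- once it vanishes, `a` is geometric with ratio `z`.
    have hzero : aeval (leftShift ℂ) (X - C z) a = 0 := by
      refine ih (fun w hw => hs w (Multiset.mem_cons_of_mem hw)) ⟨B + ‖z‖ * B, fun k => ?_⟩ ?_
      · rw [hval]
        refine (norm_sub_le _ _).trans (add_le_add (hB _) ?_)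
        rw [norm_mul]
        exact mul_le_mul_of_nonneg_left (hB k) (norm_nonneg _)
      · rw [← h, Multiset.map_cons, Multiset.prod_cons, mul_comm, map_mul, Module.End.mul_apply]
    have hrec : ∀ k j, ‖a (k + j)‖ = ‖z‖ ^ j * ‖a k‖ := by
      intro k j
      induction j with
      | zero => simp
      | succ j ihj =>
        have := congrFun hzero (k + j)
        rw [hval, Pi.zero_apply, sub_eq_zero] at this
        rw [← add_assoc, this, norm_mul, ihj, pow_succ]
        ring
    funext k
    by_contra hne
    have hpos : 0 < ‖a k‖ := norm_pos_iff.2 hne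
    obtain ⟨j, hj⟩ := pow_unbounded_of_one_lt (B / ‖a k‖) hz
    rw [div_lt_iff₀ hpos, ← hrec] at hj
    exact absurd (hB _) (not_le.2 hj)

/-- The recurrence expresses `Q(0) a k` as minus a nonnegative combination of later terms, so an
upper bound yields a lower bound. -/
theorem bounded_of_nonneg_recurrence {Q : ℝ[X]} (hQ : ∀ j, 0 ≤ Q.coeff j) (hQ0 : 0 < Q.coeff 0)
    {a : ℕ → ℝ} (ha : BddAbove (Set.range a))
    (h : ∀ k, ∑ j ∈ Finset.range (Q.natDegree + 1), Q.coeff j * a (k + j) = 0) :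
    ∃ B, ∀ k, |a k| ≤ B := by
  obtain ⟨M, hM⟩ := ha
  replace hM : ∀ k, a k ≤ M := fun k => hM ⟨k, rfl⟩
  set S := ∑ j ∈ Finset.range Q.natDegree, Q.coeff (j + 1) with hS
  have hlow : ∀ k, -(S * M) / Q.coeff 0 ≤ a k := fun k => by
    have hk := h k
    rw [Finset.sum_range_succ'] at hk
    have hle : ∑ j ∈ Finset.range Q.natDegree, Q.coeff (j + 1) * a (k + (j + 1)) ≤ S * M := by
      rw [hS, Finset.sum_mul]
      exact Finset.sum_le_sum fun j _ => mul_le_mul_of_nonneg_left (hM _) (hQ _)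
    rw [div_le_iff₀ hQ0]
    simp only [add_zero] at hk
    linarith
  exact ⟨max M (-(-(S * M) / Q.coeff 0)), fun k => abs_le.2
    ⟨by have := le_max_right M (-(-(S * M) / Q.coeff 0)); linarith [hlow k],
      (hM k).trans (le_max_left _ _)⟩⟩

theorem eq_zero_of_bddAbove_of_recurrence {Q : ℝ[X]} (hQ : ∀ j, 0 ≤ Q.coeff j)
    (hQ0 : 0 < Q.coeff 0) (hroot : ∀ z : ℂ, (Q.map (algebraMap ℝ ℂ)).IsRoot z → 1 < ‖z‖)
    {a : ℕ → ℝ} (ha : BddAbove (Set.range a))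
    (h : ∀ k, ∑ j ∈ Finset.range (Q.natDegree + 1), Q.coeff j * a (k + j) = 0) (k : ℕ) :
    a k = 0 := by
  obtain ⟨B, hB⟩ := bounded_of_nonneg_recurrence hQ hQ0 ha h
  set P := Q.map (algebraMap ℝ ℂ) with hP
  have hP0 : P ≠ 0 := fun h0 => by
    have := congrArg (fun p : ℂ[X] => p.coeff 0) h0
    simp [hP, coeff_map] at this
    exact hQ0.ne' this
  have hzero : aeval (leftShift ℂ) P (fun k => (a k : ℂ)) = 0 := by
    funext k
    rw [aeval_leftShift_apply, hP, natDegree_map]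
    simp only [coeff_map, Complex.coe_algebraMap, Pi.zero_apply]
    exact_mod_cast h k
  have hprod : aeval (leftShift ℂ) (P.roots.map fun z => X - C z).prod (fun k => (a k : ℂ)) = 0 := by
    rw [(IsAlgClosed.splits P).eq_prod_roots, map_mul, aeval_C, Module.End.mul_apply,
      Module.algebraMap_end_apply] at hzero
    exact (smul_eq_zero.1 hzero).resolve_left (leadingCoeff_ne_zero.2 hP0)
  have := eq_zero_of_bounded_of_aeval_leftShift_prod P.roots
    (fun z hz => hroot z (isRoot_of_mem_roots hz)) ⟨B, fun k => by simpa using hB k⟩ hprod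
  exact Complex.ofReal_eq_zero.1 (congrFun this k)

/-! ### Cyclic and convex-cyclic vectors -/

section Operators

variable {𝕜 X : Type*} [RCLike 𝕜] [NormedAddCommGroup X] [NormedSpace 𝕜 X]

theorem iterate_eq_pow_apply (T : X →L[𝕜] X) (k : ℕ) (v : X) :
    (⇑T)^[k] v = ((T : X →ₗ[𝕜] X) ^ k) v := by
  rw [Module.End.pow_apply]
  rfl

theorem aeval_apply_mem_span_operatorOrbit (T : X →L[𝕜] X) (v : X) (p : 𝕜[X]) :
    aeval (T : X →ₗ[𝕜] X) p v ∈ Submodule.span 𝕜 (operatorOrbit T v) := by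
  rw [aeval_eq_sum_range, LinearMap.sum_apply]
  refine Submodule.sum_mem _ fun j _ => ?_
  rw [LinearMap.smul_apply, ← iterate_eq_pow_apply]
  exact Submodule.smul_mem _ _ (Submodule.subset_span ⟨j, rfl⟩)

theorem isCyclicVector_iff_forall_exists_aeval [FiniteDimensional 𝕜 X] {T : X →L[𝕜] X} {v : X} :
    IsCyclicVector T v ↔ ∀ w, ∃ p : 𝕜[X], aeval (T : X →ₗ[𝕜] X) p v = w := by
  constructor
  · intro h w
    have htop : (Submodule.span 𝕜 (operatorOrbit T v) : Set X) = Set.univ := by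
      rw [← (Submodule.closed_of_finiteDimensional _).closure_eq]
      exact h.closure_eq
    have hw : w ∈ Submodule.span 𝕜 (operatorOrbit T v) := by
      rw [← SetLike.mem_coe, htop]
      trivial
    induction hw using Submodule.span_induction with
    | mem x hx =>
      obtain ⟨k, rfl⟩ := hx
      exact ⟨Polynomial.X ^ k, by simp only [map_pow, aeval_X, iterate_eq_pow_apply]⟩
    | zero => exact ⟨0, by simp⟩
    | add x y _ _ hx hy =>
      obtain ⟨p, rfl⟩ := hx
      obtain ⟨q, rfl⟩ := hy
      exact ⟨p + q, by simp⟩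
    | smul c x _ hx =>
      obtain ⟨p, rfl⟩ := hx
      exact ⟨c • p, by simp⟩
  · intro h w
    obtain ⟨p, rfl⟩ := h w
    exact subset_closure (aeval_apply_mem_span_operatorOrbit T v p)

/-- The cyclic vectors of a cyclic operator on a finite-dimensional space are dense. -/
theorem IsCyclicOperator.dense_isCyclicVector [FiniteDimensional 𝕜 X] {T : X →L[𝕜] X}
    (hT : IsCyclicOperator T) : Dense {v | IsCyclicVector T v} := by
  obtain ⟨v, hv⟩ := hT
  rw [isCyclicVector_iff_forall_exists_aeval] at hv
  intro w
  obtain ⟨p, hp⟩ := hv w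
  set L : Module.End 𝕜 X := (T : X →ₗ[𝕜] X) with hL
  have hF : ({ε : 𝕜 | (aeval L p).HasEigenvalue (-ε)}).Finite :=
    ((aeval L p).finite_hasEigenvalue).preimage neg_injective.injOn
  -- With `w = p(T) v`, the vector `w + ε v = (p + ε)(T) v` is cyclic whenever `(p + ε)(T)` is
  -- invertible, that is, for all but finitely many `ε`.
  have hdense : (0 : 𝕜) ∈ closure {ε : 𝕜 | (aeval L p).HasEigenvalue (-ε)}ᶜ :=
    hF.countable.dense_compl 𝕜 0
  have hcont : Continuous fun ε : 𝕜 => w + ε • v := by fun_prop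
  have hmem := map_mem_closure (t := {v | IsCyclicVector T v}) hcont hdense fun ε hε => by
    have hinj : Function.Injective (aeval L (p + C ε)) := by
      rw [injective_iff_map_eq_zero]
      intro x hx
      by_contra hx0
      refine hε (Module.End.hasEigenvalue_of_hasEigenvector (x := x)
        ⟨Module.End.mem_eigenspace_iff.2 ?_, hx0⟩)
      rw [map_add, aeval_C, LinearMap.add_apply, Module.algebraMap_end_apply] at hx
      rw [neg_smul]
      exact eq_neg_of_add_eq_zero_left hx
    have hsurj := LinearMap.surjective_of_injective hinj
    refine isCyclicVector_iff_forall_exists_aeval.2 fun y => ?_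
    obtain ⟨x, rfl⟩ := hsurj y
    obtain ⟨q, rfl⟩ := hv x
    refine ⟨q, ?_⟩
    have hwv : w + ε • v = aeval L (p + C ε) v := by
      rw [map_add, aeval_C, LinearMap.add_apply, Module.algebraMap_end_apply, hp]
    rw [hwv, ← Module.End.mul_apply, ← Module.End.mul_apply, ← map_mul, ← map_mul, mul_comm]
  simpa using hmem

variable [NormedSpace ℝ X]

theorem IsConvexCyclicVector.isCyclicVector [IsScalarTower ℝ 𝕜 X] {T : X →L[𝕜] X} {v : X}
    (h : IsConvexCyclicVector T v) : IsCyclicVector T v := by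
  refine Dense.mono ?_ h
  refine convexHull_min Submodule.subset_span ?_
  exact ((Submodule.span 𝕜 (operatorOrbit T v)).restrictScalars ℝ).convex

/-- A real functional bounded above on the orbit of a convex-cyclic vector vanishes. -/
theorem IsConvexCyclicVector.eq_zero_of_le {T : X →L[𝕜] X} {v : X}
    (h : IsConvexCyclicVector T v) (g : X →L[ℝ] ℝ) {M : ℝ} (hg : ∀ k : ℕ, g ((⇑T)^[k] v) ≤ M)
    (x : X) : g x = 0 := by
  have hclosed : IsClosed {x | g x ≤ M} := isClosed_le g.continuous continuous_const
  have hsub : convexHull ℝ (operatorOrbit T v) ⊆ {x | g x ≤ M} :=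
    convexHull_min (by rintro _ ⟨k, rfl⟩; exact hg k) (convex_halfSpace_le g.toLinearMap.isLinear M)
  have hall : ∀ x, g x ≤ M := fun x => closure_minimal hsub hclosed (h x)
  by_contra hx
  have := hall (((M + 1) / g x) • x)
  rw [map_smul, smul_eq_mul, div_mul_cancel₀ _ hx] at this
  linarith

theorem isConvexCyclicVector_of_nonneg_coeff_annihilator [IsScalarTower ℝ 𝕜 X]
    {T : X →L[𝕜] X} {v : X} {Q : ℝ[X]} (hQ : ∀ j, 0 ≤ Q.coeff j) (hQ0 : 0 < Q.coeff 0)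
    (hroot : ∀ z : ℂ, (Q.map (algebraMap ℝ ℂ)).IsRoot z → 1 < ‖z‖)
    (hann : aeval (T : X →ₗ[𝕜] X) (Q.map (algebraMap ℝ 𝕜)) = 0)
    (htotal : ∀ f : X →L[ℝ] ℝ, (∀ k : ℕ, f ((⇑T)^[k] v) = 0) → ∀ x, f x = 0) :
    IsConvexCyclicVector T v := by
  intro x
  by_contra hx
  obtain ⟨f, u, hfu, hux⟩ :=
    geometric_hahn_banach_closed_point (convex_convexHull ℝ (operatorOrbit T v)).closure
      isClosed_closure hx
  have hf : ∀ k : ℕ, f ((⇑T)^[k] v) < u := fun k =>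
    hfu _ (subset_closure (subset_convexHull ℝ _ ⟨k, rfl⟩))
  have hzero : ∀ k : ℕ, f ((⇑T)^[k] v) = 0 := by
    refine eq_zero_of_bddAbove_of_recurrence hQ hQ0 hroot
      ⟨u, by rintro _ ⟨k, rfl⟩; exact (hf k).le⟩ fun k => ?_
    have h0 := congrArg (fun L : X →ₗ[𝕜] X => f (L ((⇑T)^[k] v))) hann
    simp only [aeval_eq_sum_range, LinearMap.sum_apply, natDegree_map, coeff_map,
      LinearMap.smul_apply, algebraMap_smul, map_sum, map_smul, LinearMap.zero_apply, map_zero,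
      smul_eq_mul] at h0
    rw [← h0]
    refine Finset.sum_congr rfl fun j _ => ?_
    rw [← iterate_eq_pow_apply, ← Function.iterate_add_apply, add_comm]
  have h1 := hf 0
  rw [hzero 0] at h1
  rw [htotal f hzero x] at hux
  exact lt_asymm h1 hux

end Operators

/-! ### Eigenfunctionals and necessity -/

section Functionals

variable {𝕜 X : Type*} [RCLike 𝕜] [NormedAddCommGroup X] [NormedSpace 𝕜 X]

theorem apply_iterate_of_apply_eq_mul {T : X →L[𝕜] X} {φ : X → ℂ} {z : ℂ}
    (hφ : ∀ x, φ (T x) = z * φ x) (k : ℕ) (x : X) : φ ((⇑T)^[k] x) = z ^ k * φ x := by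
  induction k with
  | zero => simp
  | succ k ih => rw [Function.iterate_succ_apply', hφ, ih, pow_succ]; ring

theorem IsConvexCyclicVector.eigenfunctional_eq_zero [NormedSpace ℝ X] {T : X →L[𝕜] X} {v : X}
    (h : IsConvexCyclicVector T v) (φ : X →L[ℝ] ℂ) {z : ℂ} (hφ : ∀ x, φ (T x) = z * φ x)
    (hz : ‖z‖ ≤ 1 ∨ ∃ r : ℝ, 0 < r ∧ z = r) (x : X) : φ x = 0 := by
  have key : ∀ (c : ℂ) (x : X), (c * φ x).re = 0 := by
    intro c x
    rcases hz with hz | ⟨r, hr, rfl⟩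
    · refine h.eq_zero_of_le (Complex.reCLM.comp (c • φ)) (M := ‖c‖ * ‖φ v‖) (fun k => ?_) x
      change (c * φ ((⇑T)^[k] v)).re ≤ _
      refine (Complex.re_le_norm _).trans ?_
      rw [apply_iterate_of_apply_eq_mul hφ, norm_mul, norm_mul, norm_pow]
      refine mul_le_mul_of_nonneg_left ?_ (norm_nonneg _)
      exact mul_le_of_le_one_left (norm_nonneg _) (pow_le_one₀ (norm_nonneg _) hz)
    · have hsign : ∀ d : ℂ, (d * φ v).re ≤ 0 → (d * φ x).re = 0 := by
        intro d hd
        refine h.eq_zero_of_le (Complex.reCLM.comp (d • φ)) (M := 0) (fun k => ?_) x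
        change (d * φ ((⇑T)^[k] v)).re ≤ _
        rw [apply_iterate_of_apply_eq_mul hφ, mul_left_comm, ← Complex.ofReal_pow,
          Complex.re_ofReal_mul]
        exact mul_nonpos_of_nonneg_of_nonpos (by positivity) hd
      rcases le_total (c * φ v).re 0 with hc | hc
      · exact hsign c hc
      · have := hsign (-c) (by simpa using hc)
        rwa [neg_mul, Complex.neg_re, neg_eq_zero] at this
  have h1 := key 1 x
  have h2 := key Complex.I x
  exact Complex.ext (by simpa using h1) (by simpa using h2)

end Functionals

section ComplexFunctionals

variable {X : Type*} [NormedAddCommGroup X] [NormedSpace ℂ X]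

theorem ContinuousLinearMap.eq_zero_of_re_eq_zero (φ : X →L[ℂ] ℂ) (h : ∀ x, (φ x).re = 0) (x : X) :
    φ x = 0 := by
  have h2 := h (Complex.I • x)
  rw [map_smul, smul_eq_mul, Complex.I_mul_re, neg_eq_zero] at h2
  exact Complex.ext (h x) h2

theorem IsConvexCyclicVector.eq_zero_of_re_eq_zero {T : X →L[ℂ] X} {v : X}
    (h : IsConvexCyclicVector T v) (φ : X →L[ℂ] ℂ) (hφ : ∀ k : ℕ, (φ ((⇑T)^[k] v)).re = 0)
    (x : X) : φ x = 0 :=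
  φ.eq_zero_of_re_eq_zero (h.eq_zero_of_le (Complex.reCLM.comp (φ.restrictScalars ℝ)) (M := 0)
    fun k => (hφ k).le) x

theorem IsConvexCyclicVector.eigenfunctional_apply_ne_zero {T : X →L[ℂ] X} {v : X}
    (h : IsConvexCyclicVector T v) {φ : X →L[ℂ] ℂ} {z : ℂ} (hφ : ∀ x, φ (T x) = z * φ x)
    {x : X} (hx : φ x ≠ 0) : φ v ≠ 0 := fun h0 =>
  hx (h.eq_zero_of_re_eq_zero φ (fun k => by simp [apply_iterate_of_apply_eq_mul hφ, h0]) x)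

/-- On the orbit the two sides are complex conjugates, so their difference has zero real part there
and hence vanishes. -/
theorem IsConvexCyclicVector.conj_mul_eigenfunctional_eq {T : X →L[ℂ] X} {v : X}
    (h : IsConvexCyclicVector T v) {φ ψ : X →L[ℂ] ℂ} {z : ℂ} (hφ : ∀ x, φ (T x) = z * φ x)
    (hψ : ∀ x, ψ (T x) = (starRingEnd ℂ) z * ψ x) (x : X) :
    (starRingEnd ℂ) (ψ v) * φ x = (starRingEnd ℂ) (φ v) * ψ x := by
  have := h.eq_zero_of_re_eq_zero
    ((starRingEnd ℂ) (ψ v) • φ - (starRingEnd ℂ) (φ v) • ψ) (fun k => ?_) x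
  · exact sub_eq_zero.1 this
  · change ((starRingEnd ℂ) (ψ v) * φ ((⇑T)^[k] v) -
      (starRingEnd ℂ) (φ v) * ψ ((⇑T)^[k] v)).re = 0
    rw [apply_iterate_of_apply_eq_mul hφ, apply_iterate_of_apply_eq_mul hψ, Complex.sub_re,
      ← Complex.conj_re ((starRingEnd ℂ) (φ v) * _), sub_eq_zero]
    congr 1
    simp only [map_mul, map_pow, Complex.conj_conj]
    ring

theorem IsConvexCyclicVector.eigenvalue_ne_ofReal {T : X →L[ℂ] X} {v : X}
    (h : IsConvexCyclicVector T v) {φ : X →L[ℂ] ℂ} {z : ℂ} (hφ : ∀ x, φ (T x) = z * φ x)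
    {x : X} (hx : φ x ≠ 0) (r : ℝ) : z ≠ r := by
  rintro rfl
  have hv := h.eigenfunctional_apply_ne_zero hφ hx
  -- For real `z`, `I • φ` is an eigenfunctional for `conj z` too; evaluation at `v` gives `2i |φ
  -- v|² = 0`.
  have := h.conj_mul_eigenfunctional_eq (ψ := Complex.I • φ) hφ
    (fun y => by simp [hφ, mul_left_comm]) v
  simp only [smul_apply, smul_eq_mul, map_mul, Complex.conj_I] at this
  have h2 : 2 * Complex.I * ((starRingEnd ℂ) (φ v) * φ v) = 0 := by linear_combination -this
  simp [hv] at h2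

theorem IsConvexCyclicVector.eigenvalue_ne_conj {T : X →L[ℂ] X} {v : X}
    (h : IsConvexCyclicVector T v) {φ ψ : X →L[ℂ] ℂ} {z w : ℂ} (hφ : ∀ x, φ (T x) = z * φ x)
    (hψ : ∀ x, ψ (T x) = w * ψ x) {x y : X} (hx : φ x ≠ 0) (hy : ψ y ≠ 0) :
    z ≠ (starRingEnd ℂ) w := by
  rintro rfl
  have hv := h.eigenfunctional_apply_ne_zero hφ hx
  have hv' := h.eigenfunctional_apply_ne_zero hψ hy
  have h1 := h.conj_mul_eigenfunctional_eq hφ (by simpa using hψ)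
  have h2 := h1 (T v)
  rw [hφ, hψ] at h2
  -- Comparing the identity at `v` and at `T v` forces `w` to be real, which is already excluded.
  have h3 : ((starRingEnd ℂ) w - w) * ((starRingEnd ℂ) (ψ v) * φ v) = 0 := by
    linear_combination h2 - w * h1 v
  have h4 : (starRingEnd ℂ) w = w := by
    refine sub_eq_zero.1 ((mul_eq_zero.1 h3).resolve_right ?_)
    exact mul_ne_zero (by simpa using hv') hv
  obtain ⟨r, hr⟩ := Complex.conj_eq_iff_real.1 h4
  exact h.eigenvalue_ne_ofReal hψ hy r hr

end ComplexFunctionals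

/-! ### Real functionals vanishing on an orbit -/

theorem apply_aeval_map_eq_zero {𝕜 X : Type*} [RCLike 𝕜] [NormedAddCommGroup X] [NormedSpace 𝕜 X]
    [NormedSpace ℝ X] [IsScalarTower ℝ 𝕜 X] {T : X →L[𝕜] X} {v : X} (f : X →L[ℝ] ℝ)
    (hf : ∀ k : ℕ, f ((⇑T)^[k] v) = 0) (r : ℝ[X]) :
    f (aeval (T : X →ₗ[𝕜] X) (r.map (algebraMap ℝ 𝕜)) v) = 0 := by
  simp only [aeval_eq_sum_range, LinearMap.sum_apply, natDegree_map, coeff_map,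
    LinearMap.smul_apply, algebraMap_smul, map_sum, map_smul, ← iterate_eq_pow_apply, hf, smul_zero,
    Finset.sum_const_zero]

theorem exists_map_eq_add_map_conj (q : ℂ[X]) :
    ∃ r : ℝ[X], r.map (algebraMap ℝ ℂ) = q + q.map (starRingEnd ℂ) := by
  have : q + q.map (starRingEnd ℂ) ∈ lifts (algebraMap ℝ ℂ) :=
    (lifts_iff_coeff_lifts _).2 fun j =>
      ⟨2 * (q.coeff j).re, by rw [coeff_add, coeff_map, Complex.add_conj]; simp⟩
  obtain ⟨r, hr⟩ := (mem_lifts _).1 this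
  exact ⟨r, hr⟩

theorem IsCyclicVector.real_functional_eq_zero {X : Type*} [NormedAddCommGroup X] [NormedSpace ℝ X]
    [FiniteDimensional ℝ X] {T : X →L[ℝ] X} {v : X} (hv : IsCyclicVector T v) (f : X →L[ℝ] ℝ)
    (hf : ∀ k : ℕ, f ((⇑T)^[k] v) = 0) (x : X) : f x = 0 := by
  obtain ⟨p, rfl⟩ := isCyclicVector_iff_forall_exists_aeval.1 hv x
  simpa using apply_aeval_map_eq_zero f hf p

/-- If an annihilating polynomial is coprime to its conjugate, then every complex polynomial in the
operator is a real one, so real functionals vanishing on the orbit of a cyclic vector vanish. -/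
theorem IsCyclicVector.real_functional_eq_zero_of_isCoprime {X : Type*} [NormedAddCommGroup X]
    [NormedSpace ℂ X] [FiniteDimensional ℂ X] {T : X →L[ℂ] X} {v : X} (hv : IsCyclicVector T v)
    {χ : ℂ[X]} (hχ : aeval (T : X →ₗ[ℂ] X) χ = 0) (hcop : IsCoprime χ (χ.map (starRingEnd ℂ)))
    (f : X →L[ℝ] ℝ) (hf : ∀ k : ℕ, f ((⇑T)^[k] v) = 0) (x : X) : f x = 0 := by
  obtain ⟨p, rfl⟩ := isCyclicVector_iff_forall_exists_aeval.1 hv x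
  obtain ⟨a, b, hab⟩ := hcop
  -- Modulo `χ`, Bézout gives `p ≡ p b χ̄`; adding the conjugate, a multiple of `χ`, makes the
  -- coefficients real without changing the operator.
  obtain ⟨r, hr⟩ := exists_map_eq_add_map_conj (p * b * χ.map (starRingEnd ℂ))
  have hmap : (χ.map (starRingEnd ℂ)).map (starRingEnd ℂ) = χ := by
    ext j
    simp
  have hp : aeval (T : X →ₗ[ℂ] X) p = aeval (T : X →ₗ[ℂ] X) (r.map (algebraMap ℝ ℂ)) := by
    have h1 : p = p * b * χ.map (starRingEnd ℂ) + p * a * χ := by linear_combination -p * hab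
    conv_lhs => rw [h1]
    rw [hr, Polynomial.map_mul (starRingEnd ℂ) (p := p * b), hmap, map_add, map_add, map_mul _ _ χ,
      map_mul _ _ χ, hχ, mul_zero, mul_zero]
  rw [hp]
  exact apply_aeval_map_eq_zero f hf r

/-! ### Eigenvalues of matrices and assembly of the theorem -/

section Matrices

variable {n : ℕ}

theorem mem_complexEigenvalues_iff_isRoot_charpoly (A : Matrix (Fin n) (Fin n) ℂ) (z : ℂ) :
    z ∈ complexEigenvalues A ↔ A.charpoly.IsRoot z := by
  rw [complexEigenvalues, Set.mem_ofPred_eq, Module.End.hasEigenvalue_iff_isRoot_charpoly,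
    Matrix.charpoly_toLin']

theorem exists_left_eigenvector {A : Matrix (Fin n) (Fin n) ℂ} {z : ℂ}
    (hz : z ∈ complexEigenvalues A) : ∃ w : Fin n → ℂ, w ≠ 0 ∧ Matrix.vecMul w A = z • w := by
  rw [mem_complexEigenvalues_iff_isRoot_charpoly, ← Matrix.charpoly_transpose,
    ← mem_complexEigenvalues_iff_isRoot_charpoly] at hz
  obtain ⟨w, hw⟩ := Module.End.HasEigenvalue.exists_hasEigenvector hz
  refine ⟨w, hw.2, ?_⟩
  have := hw.apply_eq_smul
  rwa [Matrix.toLin'_apply, Matrix.mulVec_transpose] at this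

theorem exists_complex_eigenfunctional {A : Matrix (Fin n) (Fin n) ℂ} {z : ℂ}
    (hz : z ∈ complexEigenvalues A) :
    ∃ φ : (Fin n → ℂ) →L[ℂ] ℂ, (∃ x, φ x ≠ 0) ∧ ∀ x, φ (matrixOperator A x) = z * φ x := by
  obtain ⟨w, hw, hA⟩ := exists_left_eigenvector hz
  obtain ⟨i, hi⟩ := Function.ne_iff.1 hw
  refine ⟨LinearMap.toContinuousLinearMap (dotProductBilin ℂ ℂ w), ⟨Pi.single i 1, ?_⟩, fun x => ?_⟩
  · change w ⬝ᵥ Pi.single i 1 ≠ 0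
    simpa using hi
  · change w ⬝ᵥ A.mulVec x = z * (w ⬝ᵥ x)
    rw [Matrix.dotProduct_mulVec, hA, smul_dotProduct, smul_eq_mul]

theorem exists_real_eigenfunctional {A : Matrix (Fin n) (Fin n) ℝ} {z : ℂ}
    (hz : z ∈ complexEigenvalues (A.map (fun r : ℝ => (r : ℂ)))) :
    ∃ φ : (Fin n → ℝ) →L[ℝ] ℂ, (∃ x, φ x ≠ 0) ∧ ∀ x, φ (matrixOperator A x) = z * φ x := by
  obtain ⟨w, hw, hA⟩ := exists_left_eigenvector hz
  obtain ⟨i, hi⟩ := Function.ne_iff.1 hw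
  refine ⟨LinearMap.toContinuousLinearMap
    ((dotProductBilin ℂ ℂ w).restrictScalars ℝ ∘ₗ Complex.ofRealCLM.toLinearMap.compLeft (Fin n)),
    ⟨Pi.single i 1, ?_⟩, fun x => ?_⟩
  · change w ⬝ᵥ (fun j => ((Pi.single i 1 : Fin n → ℝ) j : ℂ)) ≠ 0
    have : (fun j => ((Pi.single i 1 : Fin n → ℝ) j : ℂ)) = Pi.single i 1 := by
      funext j
      by_cases h : j = i
      · subst h; simp
      · simp [h]
    rw [this]
    simpa using hi
  · change w ⬝ᵥ (fun j => ((A.mulVec x j : ℝ) : ℂ)) = z * (w ⬝ᵥ fun j => (x j : ℂ))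
    have : (fun j => ((A.mulVec x j : ℝ) : ℂ)) =
        (A.map (fun r : ℝ => (r : ℂ))).mulVec fun j => (x j : ℂ) := by
      funext j
      simp [Matrix.mulVec, dotProduct]
    rw [this, Matrix.dotProduct_mulVec, hA, smul_dotProduct, smul_eq_mul]

theorem IsConvexCyclicVector.complexEigenvalues_subset_of_real {A : Matrix (Fin n) (Fin n) ℝ}
    {v : Fin n → ℝ} (h : IsConvexCyclicVector (matrixOperator A) v) :
    complexEigenvalues (A.map (fun r : ℝ => (r : ℂ))) ⊆
      (Metric.closedBall (0 : ℂ) 1 ∪ {z : ℂ | ∃ r : ℝ, 0 < r ∧ z = (r : ℂ)})ᶜ := by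
  intro z hz hmem
  obtain ⟨φ, ⟨x, hx⟩, hφ⟩ := exists_real_eigenfunctional hz
  refine hx (h.eigenfunctional_eq_zero φ hφ ?_ x)
  exact hmem.imp_left fun h1 => by simpa using h1

theorem IsConvexCyclicVector.complexEigenvalues_subset {A : Matrix (Fin n) (Fin n) ℂ}
    {v : Fin n → ℂ} (h : IsConvexCyclicVector (matrixOperator A) v) :
    complexEigenvalues A ⊆ (Metric.closedBall (0 : ℂ) 1 ∪ {z : ℂ | ∃ r : ℝ, z = (r : ℂ)})ᶜ := by
  intro z hz hmem
  obtain ⟨φ, ⟨x, hx⟩, hφ⟩ := exists_complex_eigenfunctional hz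
  rcases hmem with hmem | ⟨r, hr⟩
  · exact hx (h.eigenfunctional_eq_zero (φ.restrictScalars ℝ) hφ
      (Or.inl (by simpa using hmem)) x)
  · exact h.eigenvalue_ne_ofReal hφ hx r hr

theorem IsConvexCyclicVector.complexEigenvalues_ne_conj {A : Matrix (Fin n) (Fin n) ℂ}
    {v : Fin n → ℂ} (h : IsConvexCyclicVector (matrixOperator A) v) {μ ν : ℂ}
    (hμ : μ ∈ complexEigenvalues A) (hν : ν ∈ complexEigenvalues A) : μ ≠ (starRingEnd ℂ) ν := by
  obtain ⟨φ, ⟨x, hx⟩, hφ⟩ := exists_complex_eigenfunctional hμ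
  obtain ⟨ψ, ⟨y, hy⟩, hψ⟩ := exists_complex_eigenfunctional hν
  exact h.eigenvalue_ne_conj hφ hψ hx hy

theorem exists_nonneg_coeff_multiple_charpoly {A : Matrix (Fin n) (Fin n) ℂ}
    (hA : ∀ z ∈ complexEigenvalues A, 1 < ‖z‖ ∧ ∀ r : ℝ, 0 < r → z ≠ r) :
    ∃ Q : ℝ[X], (∀ j, 0 ≤ Q.coeff j) ∧ 0 < Q.coeff 0 ∧
      (∀ z : ℂ, (Q.map (algebraMap ℝ ℂ)).IsRoot z → 1 < ‖z‖) ∧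
      aeval A (Q.map (algebraMap ℝ ℂ)) = 0 := by
  obtain ⟨Q, hQ, hQ0, hdvd, hroot⟩ := exists_nonneg_coeff_multiple A.charpoly.roots
    fun z hz => hA z ((mem_complexEigenvalues_iff_isRoot_charpoly A z).2 (isRoot_of_mem_roots hz))
  rw [← (IsAlgClosed.splits A.charpoly).eq_prod_roots_of_monic A.charpoly_monic] at hdvd
  exact ⟨Q, hQ, hQ0, hroot, aeval_eq_zero_of_dvd_aeval_eq_zero hdvd A.aeval_self_charpoly⟩

theorem aeval_matrixOperator {𝕜 : Type*} [RCLike 𝕜] (A : Matrix (Fin n) (Fin n) 𝕜) (p : 𝕜[X]) :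
    aeval (matrixOperator A : (Fin n → 𝕜) →ₗ[𝕜] (Fin n → 𝕜)) p = Matrix.toLin' (aeval A p) :=
  aeval_algHom_apply (Matrix.toLinAlgEquiv' : Matrix (Fin n) (Fin n) 𝕜 ≃ₐ[𝕜] _) A p

theorem IsCyclicVector.isConvexCyclicVector_of_real {A : Matrix (Fin n) (Fin n) ℝ} {v : Fin n → ℝ}
    (hv : IsCyclicVector (matrixOperator A) v)
    (hA : complexEigenvalues (A.map (fun r : ℝ => (r : ℂ))) ⊆
      (Metric.closedBall (0 : ℂ) 1 ∪ {z : ℂ | ∃ r : ℝ, 0 < r ∧ z = (r : ℂ)})ᶜ) :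
    IsConvexCyclicVector (matrixOperator A) v := by
  obtain ⟨Q, hQ, hQ0, hroot, hann⟩ := exists_nonneg_coeff_multiple_charpoly fun z hz =>
    ⟨not_le.1 fun h => hA hz (Or.inl (by simpa using h)),
      fun r hr h => hA hz (Or.inr ⟨r, hr, h⟩)⟩
  refine isConvexCyclicVector_of_nonneg_coeff_annihilator hQ hQ0 hroot ?_
    hv.real_functional_eq_zero
  have h0 : aeval A Q = 0 := by
    have h1 := aeval_algHom_apply (Complex.ofRealAm.mapMatrix (m := Fin n)) A Q
    rw [aeval_map_algebraMap] at hann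
    have h2 : (Complex.ofRealAm.mapMatrix (m := Fin n)) (aeval A Q) = 0 := h1.symm.trans hann
    ext i j
    have h3 := congrFun (congrFun h2 i) j
    exact Complex.ofReal_eq_zero.1 h3
  rw [aeval_matrixOperator, aeval_map_algebraMap, h0, map_zero]

/-- A common root `z` would make both `z` and `conj z` eigenvalues. -/
theorem isCoprime_charpoly_map_conj {A : Matrix (Fin n) (Fin n) ℂ}
    (hA : ∀ μ ∈ complexEigenvalues A, ∀ ν ∈ complexEigenvalues A, μ ≠ (starRingEnd ℂ) ν) :
    IsCoprime A.charpoly (A.charpoly.map (starRingEnd ℂ)) := by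
  rw [Polynomial.isCoprime_iff_aeval_ne_zero_of_isAlgClosed (k := ℂ) ℂ]
  intro z
  by_contra! h
  simp only [coe_aeval_eq_eval] at h
  refine hA z ((mem_complexEigenvalues_iff_isRoot_charpoly A z).2 h.1) ((starRingEnd ℂ) z)
    ((mem_complexEigenvalues_iff_isRoot_charpoly A _).2 ?_) (Complex.conj_conj z).symm
  have h2 : (starRingEnd ℂ) (A.charpoly.eval ((starRingEnd ℂ) z)) = 0 := by
    rw [← eval_map_apply, Complex.conj_conj]
    exact h.2
  simpa using h2

theorem IsCyclicVector.isConvexCyclicVector_of_complex {A : Matrix (Fin n) (Fin n) ℂ}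
    {v : Fin n → ℂ} (hv : IsCyclicVector (matrixOperator A) v)
    (hA : complexEigenvalues A ⊆ (Metric.closedBall (0 : ℂ) 1 ∪ {z : ℂ | ∃ r : ℝ, z = (r : ℂ)})ᶜ)
    (hconj : ∀ μ ∈ complexEigenvalues A, ∀ ν ∈ complexEigenvalues A, μ ≠ (starRingEnd ℂ) ν) :
    IsConvexCyclicVector (matrixOperator A) v := by
  obtain ⟨Q, hQ, hQ0, hroot, hann⟩ := exists_nonneg_coeff_multiple_charpoly fun z hz =>
    ⟨not_le.1 fun h => hA hz (Or.inl (by simpa using h)), fun r _ h => hA hz (Or.inr ⟨r, h⟩)⟩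
  refine isConvexCyclicVector_of_nonneg_coeff_annihilator hQ hQ0 hroot ?_
    (hv.real_functional_eq_zero_of_isCoprime ?_ (isCoprime_charpoly_map_conj hconj))
  · rw [aeval_matrixOperator]
    exact (congrArg Matrix.toLin' hann).trans (map_zero _)
  · rw [aeval_matrixOperator, Matrix.aeval_self_charpoly, map_zero]

end Matrices

theorem theoremT (n : ℕ) :
    (∀ T : Matrix (Fin n) (Fin n) ℝ,
      (IsConvexCyclicOperator (matrixOperator T) ↔
        IsCyclicOperator (matrixOperator T) ∧
          complexEigenvalues (T.map (fun r : ℝ => (r : ℂ))) ⊆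
            (Metric.closedBall (0 : ℂ) 1 ∪ {z : ℂ | ∃ r : ℝ, 0 < r ∧ z = (r : ℂ)})ᶜ) ∧
      (IsConvexCyclicOperator (matrixOperator T) →
        {v | IsConvexCyclicVector (matrixOperator T) v} = {v | IsCyclicVector (matrixOperator T) v} ∧
          Dense {v | IsConvexCyclicVector (matrixOperator T) v})) ∧
    (∀ T : Matrix (Fin n) (Fin n) ℂ,
      (IsConvexCyclicOperator (matrixOperator T) ↔
        IsCyclicOperator (matrixOperator T) ∧
          complexEigenvalues T ⊆
            (Metric.closedBall (0 : ℂ) 1 ∪ {z : ℂ | ∃ r : ℝ, z = (r : ℂ)})ᶜ ∧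
          ∀ μ ∈ complexEigenvalues T, ∀ ν ∈ complexEigenvalues T,
            μ ≠ (starRingEnd ℂ) ν) ∧
      (IsConvexCyclicOperator (matrixOperator T) →
        {v | IsConvexCyclicVector (matrixOperator T) v} = {v | IsCyclicVector (matrixOperator T) v} ∧
          Dense {v | IsConvexCyclicVector (matrixOperator T) v})) := by
  refine ⟨fun T => ?_, fun T => ?_⟩
  -- One convex-cyclic vector already yields the spectral condition, which makes every cyclic vector
  -- convex-cyclic.
  · have heq : IsConvexCyclicOperator (matrixOperator T) →
        {v | IsConvexCyclicVector (matrixOperator T) v} =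
          {v | IsCyclicVector (matrixOperator T) v} := fun ⟨_, hv⟩ =>
      Set.Subset.antisymm (fun _ hw => hw.isCyclicVector) fun _ hw =>
        hw.isConvexCyclicVector_of_real hv.complexEigenvalues_subset_of_real
    refine ⟨⟨fun ⟨v, hv⟩ => ⟨⟨v, hv.isCyclicVector⟩, hv.complexEigenvalues_subset_of_real⟩,
      fun ⟨⟨v, hv⟩, hT⟩ => ⟨v, hv.isConvexCyclicVector_of_real hT⟩⟩, fun h => ⟨heq h, ?_⟩⟩
    rw [heq h]
    exact IsCyclicOperator.dense_isCyclicVector (h.imp fun _ hv => hv.isCyclicVector)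
  · have heq : IsConvexCyclicOperator (matrixOperator T) →
        {v | IsConvexCyclicVector (matrixOperator T) v} =
          {v | IsCyclicVector (matrixOperator T) v} := fun ⟨_, hv⟩ =>
      Set.Subset.antisymm (fun _ hw => hw.isCyclicVector) fun _ hw =>
        hw.isConvexCyclicVector_of_complex hv.complexEigenvalues_subset
          fun _ hμ _ hν => hv.complexEigenvalues_ne_conj hμ hν
    refine ⟨⟨fun ⟨v, hv⟩ => ⟨⟨v, hv.isCyclicVector⟩, hv.complexEigenvalues_subset,
      fun _ hμ _ hν => hv.complexEigenvalues_ne_conj hμ hν⟩,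
      fun ⟨⟨v, hv⟩, hT, hconj⟩ => ⟨v, hv.isConvexCyclicVector_of_complex hT hconj⟩⟩,
      fun h => ⟨heq h, ?_⟩⟩
    rw [heq h]
    exact IsCyclicOperator.dense_isCyclicVector (h.imp fun _ hv => hv.isCyclicVector)
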